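/- Let $n\ge 2$, $a=e^{2\pi i/n}$, and let $D=\mathrm{diag}(1,a,\dots,a^{n-1})$ and $S$ be the $n\times n$ matrix with $S_{j,j+1}=1$ for $1\le j\le n-1$, $S_{n,1}=1$ and all other entries $0$. For two elements $D,S$ of a complex Lie algebra and $1\le m,k\le n$ put $$T_m^k=(\mathrm{ad}\,D)^{k-1}(\mathrm{ad}\,S)^{m-1}(\mathrm{ad}\,D(S))\quad(m<n),\qquad T_n^k=\mathrm{ad}\,S(T_{n-1}^k).$$ (1) The matrices $D,S$ generate $\mathfrak{sl}(n)=\mathfrak{sl}(n,\mathbb C)$ as a Lie algebra. (2) The elements $D$, $S$ and $T_m^k$, $1\le k,m\le n$, with $k\ne n$ for $m=1,n$ and $k\neq 1$ for $m=n$, form a basis of $\mathfrak{sl}(n)$. (3) The following relations are a defining set of relations for these generators, i.e. $\mathfrak{sl}(n)$ is the quotient of the free complex Lie algebra on two generators $D,S$ by the ideal generated by these relations, via the isomorphism that sends the generators to the matrices $D,S$: $$(\mathrm{ad}\,D)^n(S)=(1-a)^nS,$$ $$(\mathrm{ad}\,D)^n\big((\mathrm{ad}\,S)^{m-1}(\mathrm{ad}\,D(S))\big)=(1-a^m)^n(\mathrm{ad}\,S)^{m-1}(\mathrm{ad}\,D(S))\qquad(2\le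 m\le n-1),$$ $$\mathrm{ad}\,S(T_{n-1}^1)=(-1)^{n-1}(1-a)^nD,\qquad \mathrm{ad}\,S(T_{n-1}^n)=0,$$ $$\mathrm{ad}\,S(T_n^k)=(-1)^n(1-a^k)^2(1-a^{n-1})^{k-1}(1-a)^{n-k-1}T_1^k,\qquad \mathrm{ad}\,D(T_n^k)=0\qquad(2\le k\le n-1),$$ and, for each $T_m^k$ with $2\le m\le n-1$, $1\le k\le n$, $(m,k)\ne(2,2)$, the $m-1$ relations $$(\mathrm{ad}\,S)^{s_1}\big((\mathrm{ad}\,D)^{k-1}((\mathrm{ad}\,S)^{s_2}(T_1^1))\big)=\left(\frac{1-a^k}{1-a}\right)^{s_1}\left(\frac{1-a^{s_2+1}}{1-a^m}\right)^{k-1}T_m^k,$$ where $s_1+s_2=m-1$ and $s_1=1,\dots,m-1$. -/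

import Mathlib

namespace Sylvester

/-- The primitive `n`-th root of unity `a = exp(2πi/n)`. -/
noncomputable def rootA (n : ℕ) : ℂ := Complex.exp (2 * Real.pi * Complex.I / n)

/-- The clock matrix `diag(1, a, a², …, a^(n-1))`. -/
noncomputable def clockMatrix (n : ℕ) : Matrix (Fin n) (Fin n) ℂ :=
  Matrix.diagonal fun j => rootA n ^ (j : ℕ)

/-- The cyclic shift matrix: ones on the superdiagonal and in the lower left corner. -/
def shiftMatrix (n : ℕ) : Matrix (Fin n) (Fin n) ℂ :=
  Matrix.of fun i j => if (j : ℕ) = ((i : ℕ) + 1) % n then 1 else 0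

theorem clockMatrix_mem {n : ℕ} (hn : 2 ≤ n) :
    clockMatrix n ∈ LieAlgebra.SpecialLinear.sl (Fin n) ℂ := by
  have h := (Complex.isPrimitiveRoot_exp n (by omega)).geom_sum_eq_zero (by omega)
  change (clockMatrix n).trace = 0
  rw [clockMatrix, Matrix.trace_diagonal]
  rw [Finset.sum_range] at h
  exact h

theorem shiftMatrix_mem {n : ℕ} (hn : 2 ≤ n) :
    shiftMatrix n ∈ LieAlgebra.SpecialLinear.sl (Fin n) ℂ := by
  change (shiftMatrix n).trace = 0
  refine Finset.sum_eq_zero fun i _ => ?_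
  have hi := i.isLt
  simp only [shiftMatrix, Matrix.diag_apply, Matrix.of_apply, ite_eq_right_iff, one_ne_zero,
    imp_false]
  rcases Nat.lt_or_ge ((i : ℕ) + 1) n with h | h
  · rw [Nat.mod_eq_of_lt h]; omega
  · have h2 : (i : ℕ) + 1 = n := by omega
    rw [h2, Nat.mod_self]; omega

/-- The clock matrix as an element of `sl(n)`. -/
noncomputable def clock (n : ℕ) (hn : 2 ≤ n) : LieAlgebra.SpecialLinear.sl (Fin n) ℂ :=
  ⟨clockMatrix n, clockMatrix_mem hn⟩

/-- The shift matrix as an element of `sl(n)`. -/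
def shift (n : ℕ) (hn : 2 ≤ n) : LieAlgebra.SpecialLinear.sl (Fin n) ℂ :=
  ⟨shiftMatrix n, shiftMatrix_mem hn⟩

/-- `iterAd x j y = (ad x)^j (y)`. -/
noncomputable def iterAd {L : Type*} [LieRing L] [LieAlgebra ℂ L] (x : L) (j : ℕ) (y : L) : L :=
  ((LieAlgebra.ad ℂ L x) ^ j) y

/-- The iterated brackets `T_m^k` (`1 ≤ m, k ≤ n`) of two elements `d`, `s` of a Lie algebra:
`T_m^k = (ad d)^(k-1) (ad s)^(m-1) (ad d (s))` for `m < n`, and `T_n^k = ad s (T_{n-1}^k)`. -/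
noncomputable def T {L : Type*} [LieRing L] [LieAlgebra ℂ L] (n : ℕ) (d s : L) (m k : ℕ) : L :=
  if m = n then ⁅s, iterAd d (k - 1) (iterAd s (n - 2) ⁅d, s⁆)⁆
  else iterAd d (k - 1) (iterAd s (m - 1) ⁅d, s⁆)

/-- The pairs `(m, k)` for which `T_m^k` is a member of the basis: `1 ≤ m, k ≤ n`, with
`k ≠ n` for `m = 1, n` and `k ≠ 1` for `m = n`. -/
def BasisIndex (n : ℕ) : Type :=
  {p : ℕ × ℕ // (1 ≤ p.1 ∧ p.1 ≤ n) ∧ (1 ≤ p.2 ∧ p.2 ≤ n) ∧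
    (p.1 = 1 ∨ p.1 = n → p.2 ≠ n) ∧ (p.1 = n → p.2 ≠ 1)}

/-- The two letters that generate the free Lie algebra. -/
inductive Gen : Type
  | D
  | S

/-- The family consisting of `d`, `s` and the `T_m^k` with `(m, k)` an admissible index. -/
noncomputable def basisFamily {L : Type*} [LieRing L] [LieAlgebra ℂ L] (n : ℕ) (d s : L) :
    Gen ⊕ BasisIndex n → L
  | Sum.inl Gen.D => d
  | Sum.inl Gen.S => s
  | Sum.inr p => T n d s p.1.1 p.1.2

/-- `Relation n d s l r` says that `l = r` is one of the listed relations for `d` and `s`;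
it only lists pairs (left-hand side, right-hand side) and does not assert that they agree. -/
inductive Relation {L : Type*} [LieRing L] [LieAlgebra ℂ L] (n : ℕ) (d s : L) : L → L → Prop
  | rel1 : Relation n d s (iterAd d n s) ((1 - rootA n) ^ n • s)
  | rel2 (m : ℕ) (hm : 2 ≤ m) (hm' : m ≤ n - 1) :
      Relation n d s (iterAd d n (iterAd s (m - 1) ⁅d, s⁆))
        ((1 - rootA n ^ m) ^ n • iterAd s (m - 1) ⁅d, s⁆)
  | rel3 : Relation n d s ⁅s, T n d s (n - 1) 1⁆ (((-1) ^ (n - 1) * (1 - rootA n) ^ n) • d)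
  | rel4 : Relation n d s ⁅s, T n d s (n - 1) n⁆ 0
  | rel5 (k : ℕ) (hk : 2 ≤ k) (hk' : k ≤ n - 1) :
      Relation n d s ⁅s, T n d s n k⁆
        (((-1) ^ n * (1 - rootA n ^ k) ^ 2 * (1 - rootA n ^ (n - 1)) ^ (k - 1) *
          (1 - rootA n) ^ (n - k - 1)) • T n d s 1 k)
  | rel6 (k : ℕ) (hk : 2 ≤ k) (hk' : k ≤ n - 1) :
      Relation n d s ⁅d, T n d s n k⁆ 0
  | path (m k s₁ s₂ : ℕ) (hm : 2 ≤ m) (hm' : m ≤ n - 1) (hk : 1 ≤ k) (hk' : k ≤ n)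
      (hmk : (m, k) ≠ (2, 2)) (hs : s₁ + s₂ = m - 1) (hs₁ : 1 ≤ s₁) :
      Relation n d s (iterAd s s₁ (iterAd d (k - 1) (iterAd s s₂ (T n d s 1 1))))
        ((((1 - rootA n ^ k) / (1 - rootA n)) ^ s₁ *
          ((1 - rootA n ^ (s₂ + 1)) / (1 - rootA n ^ m)) ^ (k - 1)) • T n d s m k)

/-- The ideal of the free Lie algebra on `D`, `S` generated by the elements `l - r`,
for `l = r` a listed relation between the two free generators. -/
noncomputable def relationIdeal (n : ℕ) : LieIdeal ℂ (FreeLieAlgebra ℂ Gen) :=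
  LieSubmodule.lieSpan ℂ (FreeLieAlgebra ℂ Gen)
    {x | ∃ l r, Relation n (FreeLieAlgebra.of ℂ Gen.D) (FreeLieAlgebra.of ℂ Gen.S) l r ∧
      x = l - r}

end Sylvester

namespace Sylvester

/-! ### Brackets and relations under morphisms of Lie algebras -/

section LieAlgebra

variable {L M : Type*} [LieRing L] [LieAlgebra ℂ L] [LieRing M] [LieAlgebra ℂ M]

/-! The matrices satisfy `SD = aDS`, so `ad D` and `ad S` send a monomial `D^k S^m` to a multiple of
`D^(k+1) S^m` and of `D^k S^(m+1)`, exponents counting mod `n`. Hence `T_m^k` is an explicit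
multiple of `D^k S^m`, and each relation reduces to an identity of scalars. The monomials form a
basis of all matrices (Vandermonde), and the admissible family hits each one except the identity
exactly once, with nonzero coefficient; taking traces gives a basis of `sl(n)`, and with it
generation.

For the presentation, the relations alone make the span of `d`, `s` and the `T_m^k` stable under `ad
d` and `ad s` (`lie_basisFamily_mem_span`), so this family spans any Lie algebra generated by `d`,
`s` in which they hold. The quotient of the free algebra is thus spanned by a family whose image in
`sl(n)` is independent, so the map to `sl(n)` has no further kernel (`eq_ker_of_basisFamily`). -/

theorem iterAd_zero (x y : L) : iterAd x 0 y = y := rfl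

theorem iterAd_succ (x y : L) (j : ℕ) : iterAd x (j + 1) y = ⁅x, iterAd x j y⁆ := by
  simp [iterAd, pow_succ']

theorem iterAd_succ_apply (x y : L) (j : ℕ) : iterAd x (j + 1) y = iterAd x j ⁅x, y⁆ := by
  simp [iterAd, pow_succ]

theorem iterAd_smul (x y : L) (j : ℕ) (c : ℂ) : iterAd x j (c • y) = c • iterAd x j y := by
  simp [iterAd]

theorem map_iterAd (f : L →ₗ⁅ℂ⁆ M) (x y : L) (j : ℕ) :
    f (iterAd x j y) = iterAd (f x) j (f y) := by
  induction j with
  | zero => rfl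
  | succ j ih => rw [iterAd_succ, iterAd_succ, LieHom.map_lie, ih]

theorem map_T (f : L →ₗ⁅ℂ⁆ M) (n : ℕ) (d s : L) (m k : ℕ) :
    f (T n d s m k) = T n (f d) (f s) m k := by
  unfold T
  split_ifs <;> simp [map_iterAd]

theorem map_basisFamily (f : L →ₗ⁅ℂ⁆ M) (n : ℕ) (d s : L) (i : Gen ⊕ BasisIndex n) :
    f (basisFamily n d s i) = basisFamily n (f d) (f s) i := by
  rcases i with (_ | _) | p
  · rfl
  · rfl
  · exact map_T f n d s _ _

theorem Relation.map (f : L →ₗ⁅ℂ⁆ M) {n : ℕ} {d s l r : L} (h : Relation n d s l r) :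
    Relation n (f d) (f s) (f l) (f r) := by
  cases h with
  | rel1 => simpa [map_iterAd, map_T] using Relation.rel1 (n := n) (d := f d) (s := f s)
  | rel2 m hm hm' =>
    simpa [map_iterAd, map_T] using Relation.rel2 (n := n) (d := f d) (s := f s) m hm hm'
  | rel3 => simpa [map_iterAd, map_T] using Relation.rel3 (n := n) (d := f d) (s := f s)
  | rel4 => simpa [map_iterAd, map_T] using Relation.rel4 (n := n) (d := f d) (s := f s)
  | rel5 k hk hk' =>
    simpa only [map_iterAd, map_T, LieHom.map_lie, map_smul] using
      Relation.rel5 (n := n) (d := f d) (s := f s) k hk hk'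
  | rel6 k hk hk' =>
    simpa [map_iterAd, map_T] using Relation.rel6 (n := n) (d := f d) (s := f s) k hk hk'
  | path m k s₁ s₂ hm hm' hk hk' hmk hs hs₁ =>
    simpa only [map_iterAd, map_T, LieHom.map_lie, map_smul] using
      Relation.path (n := n) (d := f d) (s := f s) m k s₁ s₂ hm hm' hk hk' hmk hs hs₁

/-- For a quotient map, this traces a relation between the classes of the generators back to one of
the elements generating the ideal. -/
theorem Relation.exists_lift (f : L →ₗ⁅ℂ⁆ M) {n : ℕ} {d s : L} {l r : M}
    (h : Relation n (f d) (f s) l r) : ∃ l' r', Relation n d s l' r' ∧ f l' = l ∧ f r' = r := by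
  cases h with
  | rel1 => exact ⟨_, _, .rel1, by simp [map_iterAd], by simp⟩
  | rel2 m hm hm' => exact ⟨_, _, .rel2 m hm hm', by simp [map_iterAd], by simp [map_iterAd]⟩
  | rel3 => exact ⟨_, _, .rel3, by simp [map_T], by simp⟩
  | rel4 => exact ⟨_, _, .rel4, by simp [map_T], by simp⟩
  | rel5 k hk hk' =>
    exact ⟨_, _, .rel5 k hk hk', by simp [map_T], by simp only [map_smul, map_T]⟩
  | rel6 k hk hk' => exact ⟨_, _, .rel6 k hk hk', by simp [map_T], by simp⟩
  | path m k s₁ s₂ hm hm' hk hk' hmk hs hs₁ =>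
    exact ⟨_, _, .path m k s₁ s₂ hm hm' hk hk' hmk hs hs₁, by simp only [map_iterAd, map_T],
      by simp only [map_smul, map_T]⟩

/-! ### Spanning as a consequence of the relations -/

theorem T_of_ne {n m : ℕ} (d s : L) (k : ℕ) (h : m ≠ n) :
    T n d s m k = iterAd d (k - 1) (iterAd s (m - 1) ⁅d, s⁆) := if_neg h

theorem T_self {n : ℕ} (hn : 2 ≤ n) (d s : L) (k : ℕ) :
    T n d s n k = ⁅s, T n d s (n - 1) k⁆ := by
  rw [T_of_ne d s k (by omega : n - 1 ≠ n), T, if_pos rfl]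
  rfl

theorem lie_T_left {n m k : ℕ} (d s : L) (hm : m ≠ n) (hk : 1 ≤ k) :
    ⁅d, T n d s m k⁆ = T n d s m (k + 1) := by
  obtain ⟨k, rfl⟩ := Nat.exists_eq_add_of_le' hk
  rw [T_of_ne d s _ hm, T_of_ne d s _ hm, Nat.add_sub_cancel, Nat.add_sub_cancel, iterAd_succ]

/-- The Jacobi identity, where the extra term is the bracket of `⁅s, d⁆` with its own negative. It
replaces the path relation omitted at `(m, k) = (2, 2)`. -/
theorem lie_lie_lie_comm {L : Type*} [LieRing L] (d s : L) : ⁅s, ⁅d, ⁅d, s⁆⁆⁆ = ⁅d, ⁅s, ⁅d, s⁆⁆⁆ := by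
  rw [leibniz_lie s d, ← lie_skew s d, neg_lie, lie_self, neg_zero, zero_add]

/-- The span of the `T_m^k` and the two elements is stable under the adjoint action of both. -/
theorem lie_basisFamily_mem_span {n : ℕ} (hn : 2 ≤ n) {d s : L}
    (h : ∀ l r, Relation n d s l r → l = r) (i : Gen ⊕ BasisIndex n) :
    ⁅d, basisFamily n d s i⁆ ∈ Submodule.span ℂ (Set.range (basisFamily n d s)) ∧
    ⁅s, basisFamily n d s i⁆ ∈ Submodule.span ℂ (Set.range (basisFamily n d s)) := by
  set V := Submodule.span ℂ (Set.range (basisFamily n d s))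
  have hd : d ∈ V := Submodule.subset_span ⟨Sum.inl Gen.D, rfl⟩
  have hs : s ∈ V := Submodule.subset_span ⟨Sum.inl Gen.S, rfl⟩
  have hT (m k : ℕ) (hm : 1 ≤ m) (hm' : m ≤ n) (hk : 1 ≤ k) (hk' : k ≤ n)
      (h1 : m = 1 ∨ m = n → k ≠ n) (h2 : m = n → k ≠ 1) : T n d s m k ∈ V :=
    Submodule.subset_span ⟨Sum.inr ⟨(m, k), ⟨hm, hm'⟩, ⟨hk, hk'⟩, h1, h2⟩, rfl⟩
  have hT11 : T n d s 1 1 = ⁅d, s⁆ := T_of_ne d s 1 (by omega)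
  have hds : ⁅d, s⁆ ∈ V :=
    hT11 ▸ hT 1 1 le_rfl (by omega) le_rfl (by omega) (by omega) (by omega)
  rcases i with (_ | _) | ⟨⟨m, k⟩, ⟨hm, hm'⟩, ⟨hk, hk'⟩, h1, h2⟩
  · refine ⟨?_, ?_⟩
    · change ⁅d, d⁆ ∈ V
      rw [lie_self]; exact V.zero_mem
    · change ⁅s, d⁆ ∈ V
      rw [← lie_skew]; exact V.neg_mem hds
  · refine ⟨hds, ?_⟩
    change ⁅s, s⁆ ∈ V
    rw [lie_self]; exact V.zero_mem
  change ⁅d, T n d s m k⁆ ∈ V ∧ ⁅s, T n d s m k⁆ ∈ V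
  dsimp only at hm hm' hk hk' h1 h2
  rcases eq_or_ne m n with rfl | hmn
  · rw [h _ _ (Relation.rel6 k (by omega) (by omega)),
      h _ _ (Relation.rel5 k (by omega) (by omega))]
    exact ⟨V.zero_mem, V.smul_mem _ (hT 1 k (by omega) (by omega) (by omega) (by omega)
      (by omega) (by omega))⟩
  refine ⟨?_, ?_⟩
  · rcases eq_or_ne k n with rfl | hkn
    · rw [lie_T_left d s hmn hk, T_of_ne d s _ hmn, Nat.add_sub_cancel,
        h _ _ (Relation.rel2 m (by omega) (by omega))]
      have := hT m 1 (by omega) (by omega) (by omega) (by omega) (by omega) (by omega)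
      rw [T_of_ne d s _ hmn] at this
      exact V.smul_mem _ this
    · rw [lie_T_left d s hmn hk]
      -- `T_1^n` is not in the family; it is `(ad d)^n s`, a multiple of `s`.
      by_cases h3 : m = 1 ∧ k + 1 = n
      · obtain ⟨rfl, rfl⟩ := h3
        rw [T_of_ne d s _ hmn, Nat.add_sub_cancel, Nat.sub_self, iterAd_zero,
          ← iterAd_succ_apply, h _ _ Relation.rel1]
        exact V.smul_mem _ hs
      · exact hT _ _ (by omega) (by omega) (by omega) (by omega) (by omega) (by omega)
  · rcases eq_or_ne m (n - 1) with rfl | hmn'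
    · rcases eq_or_ne k 1 with rfl | hk1
      · rw [h _ _ Relation.rel3]
        exact V.smul_mem _ hd
      rcases eq_or_ne k n with rfl | hkn
      · rw [h _ _ Relation.rel4]
        exact V.zero_mem
      rw [← T_self hn]
      exact hT _ _ (by omega) (by omega) (by omega) (by omega) (by omega) (by omega)
    · by_cases h3 : m = 1 ∧ k = 2
      · obtain ⟨rfl, rfl⟩ := h3
        have : ⁅s, T n d s 1 2⁆ = T n d s 2 2 := by
          rw [T_of_ne d s _ hmn, T_of_ne d s 2 (by omega)]
          simpa [iterAd] using lie_lie_lie_comm d s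
        rw [this]
        exact hT _ _ (by omega) (by omega) (by omega) (by omega) (by omega) (by omega)
      · have := h _ _ (Relation.path (m + 1) k 1 (m - 1) (by omega) (by omega) hk hk'
          (by simp only [ne_eq, Prod.mk.injEq]; omega) (by omega) le_rfl)
        rw [iterAd_succ, iterAd_zero, hT11, ← T_of_ne d s k hmn] at this
        rw [this]
        exact V.smul_mem _ (hT _ _ (by omega) (by omega) (by omega) (by omega) (by omega)
          (by omega))

/-- A subspace that contains a generating set and is stable under its adjoint action is
everything. -/
theorem eq_top_of_lie_mem {X : Set L} (hX : LieSubalgebra.lieSpan ℂ L X = ⊤)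
    (V : Submodule ℂ L) (hXV : X ⊆ V) (h : ∀ x ∈ X, ∀ v ∈ V, ⁅x, v⁆ ∈ V) : V = ⊤ := by
  -- The stabilizer of `V` is a subalgebra by the Jacobi identity; it contains `X`, so it is `L`.
  -- Then `V` is itself a subalgebra containing `X`.
  let N : LieSubalgebra ℂ L :=
    { carrier := {x | ∀ v ∈ V, ⁅x, v⁆ ∈ V}
      add_mem' := fun ha hb v hv => by
        rw [add_lie]; exact V.add_mem (ha v hv) (hb v hv)
      zero_mem' := fun v _ => by rw [zero_lie]; exact V.zero_mem
      smul_mem' := fun c x hx v hv => by rw [smul_lie]; exact V.smul_mem c (hx v hv)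
      lie_mem' := fun {x y} hx hy v hv => by
        rw [lie_lie]; exact V.sub_mem (hx _ (hy v hv)) (hy _ (hx v hv)) }
  have hN (x : L) : x ∈ N := by
    have : LieSubalgebra.lieSpan ℂ L X ≤ N := LieSubalgebra.lieSpan_le.2 h
    exact this (hX ▸ LieSubalgebra.mem_top x)
  let V' : LieSubalgebra ℂ L := { V with lie_mem' := fun {x y} _ hy => hN x y hy }
  have hV' : LieSubalgebra.lieSpan ℂ L X ≤ V' := LieSubalgebra.lieSpan_le.2 hXV
  exact eq_top_iff.2 fun x _ => hV' (hX ▸ LieSubalgebra.mem_top x)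

theorem span_basisFamily_eq_top {n : ℕ} (hn : 2 ≤ n) {d s : L}
    (hgen : LieSubalgebra.lieSpan ℂ L {d, s} = ⊤)
    (h : ∀ l r, Relation n d s l r → l = r) :
    Submodule.span ℂ (Set.range (basisFamily n d s)) = ⊤ := by
  refine eq_top_of_lie_mem hgen _ ?_ ?_
  · rintro x (rfl | rfl)
    · exact Submodule.subset_span ⟨Sum.inl Gen.D, rfl⟩
    · exact Submodule.subset_span ⟨Sum.inl Gen.S, rfl⟩
  · intro x hx v hv
    induction hv using Submodule.span_induction with
    | mem v hv =>
      obtain ⟨i, rfl⟩ := hv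
      rcases hx with rfl | rfl
      · exact (lie_basisFamily_mem_span hn h i).1
      · exact (lie_basisFamily_mem_span hn h i).2
    | zero => rw [lie_zero]; exact Submodule.zero_mem _
    | add v w _ _ hv hw => rw [lie_add]; exact Submodule.add_mem _ hv hw
    | smul c v _ hv => rw [lie_smul]; exact Submodule.smul_mem _ c hv

theorem iterAd_mem (K : LieSubalgebra ℂ L) {x y : L} (hx : x ∈ K) (hy : y ∈ K) (j : ℕ) :
    iterAd x j y ∈ K := by
  induction j with
  | zero => exact hy
  | succ j ih => rw [iterAd_succ]; exact K.lie_mem hx ih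

theorem basisFamily_mem (K : LieSubalgebra ℂ L) {n : ℕ} {d s : L} (hd : d ∈ K) (hs : s ∈ K)
    (i : Gen ⊕ BasisIndex n) : basisFamily n d s i ∈ K := by
  rcases i with (_ | _) | p
  · exact hd
  · exact hs
  · have hds := K.lie_mem hd hs
    change T _ _ _ _ _ ∈ K
    unfold T
    split_ifs
    · exact K.lie_mem hs (iterAd_mem K hd (iterAd_mem K hs hds _) _)
    · exact iterAd_mem K hd (iterAd_mem K hs hds _) _

end LieAlgebra

-- Monomials in the clock and shift matrices

attribute [local instance] LieRing.ofAssociativeRing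

theorem rootA_isPrimitiveRoot {n : ℕ} (hn : 2 ≤ n) : IsPrimitiveRoot (rootA n) n :=
  Complex.isPrimitiveRoot_exp n (by omega)

theorem one_sub_rootA_pow_ne_zero {n k : ℕ} (hn : 2 ≤ n) (hk : 1 ≤ k) (hkn : k < n) :
    1 - rootA n ^ k ≠ 0 :=
  sub_ne_zero.2 ((rootA_isPrimitiveRoot hn).pow_ne_one_of_pos_of_lt (by omega) hkn).symm

/-- The monomials `D^k S^m` in the clock and shift matrices. -/
noncomputable def weyl (n k m : ℕ) : Matrix (Fin n) (Fin n) ℂ :=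
  clockMatrix n ^ k * shiftMatrix n ^ m

theorem shiftMatrix_pow_apply (n m : ℕ) (i j : Fin n) :
    (shiftMatrix n ^ m) i j = if (j : ℕ) = ((i : ℕ) + m) % n then 1 else 0 := by
  induction m generalizing j with
  | zero =>
    simp [Matrix.one_apply, Nat.mod_eq_of_lt i.isLt, Fin.ext_iff, eq_comm]
  | succ m ih =>
    have hlt : ((i : ℕ) + m) % n < n := Nat.mod_lt _ (by have := i.isLt; omega)
    rw [pow_succ, Matrix.mul_apply, Finset.sum_eq_single ⟨((i : ℕ) + m) % n, hlt⟩]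
    · rw [ih]
      simp [shiftMatrix, add_assoc]
    · intro l _ hl
      rw [ih, if_neg (fun h => hl (Fin.ext h)), zero_mul]
    · simp

theorem weyl_apply (n k m : ℕ) (i j : Fin n) :
    weyl n k m i j = if (j : ℕ) = ((i : ℕ) + m) % n then (rootA n ^ (i : ℕ)) ^ k else 0 := by
  rw [weyl, clockMatrix, Matrix.diagonal_pow, Matrix.diagonal_mul, shiftMatrix_pow_apply]
  simp

theorem weyl_add_left {n : ℕ} (hn : 2 ≤ n) (k m : ℕ) : weyl n (k + n) m = weyl n k m := by
  ext i j
  rw [weyl_apply, weyl_apply, pow_add, ← pow_mul _ _ n, mul_comm _ n, pow_mul _ n,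
    (rootA_isPrimitiveRoot hn).pow_eq_one, one_pow, mul_one]

theorem weyl_add_right (n k m : ℕ) : weyl n k (m + n) = weyl n k m := by
  ext i j
  rw [weyl_apply, weyl_apply, ← add_assoc, Nat.add_mod_right]

theorem shiftMatrix_mul_clockMatrix {n : ℕ} (hn : 2 ≤ n) :
    shiftMatrix n * clockMatrix n = rootA n • (clockMatrix n * shiftMatrix n) := by
  ext i j
  rw [clockMatrix, Matrix.mul_diagonal, Matrix.smul_apply, Matrix.diagonal_mul]
  simp only [shiftMatrix, Matrix.of_apply]
  split_ifs with h
  -- The corner entry of the shift obeys the same rule because `a^n = 1`.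
  · have hpow : rootA n ^ (((i : ℕ) + 1) % n) = rootA n ^ ((i : ℕ) + 1) := by
      have := pow_mod_orderOf (rootA n) ((i : ℕ) + 1)
      rwa [← (rootA_isPrimitiveRoot hn).eq_orderOf] at this
    rw [h, hpow]
    simp [pow_succ']
  · simp

theorem shiftMatrix_pow_mul_clockMatrix {n : ℕ} (hn : 2 ≤ n) (m : ℕ) :
    shiftMatrix n ^ m * clockMatrix n =
      rootA n ^ m • (clockMatrix n * shiftMatrix n ^ m) := by
  induction m with
  | zero => simp
  | succ m ih =>
    rw [pow_succ', mul_assoc, ih, mul_smul_comm, ← mul_assoc, shiftMatrix_mul_clockMatrix hn,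
      smul_mul_assoc, smul_smul, mul_assoc, pow_succ]

theorem shiftMatrix_mul_clockMatrix_pow {n : ℕ} (hn : 2 ≤ n) (k : ℕ) :
    shiftMatrix n * clockMatrix n ^ k =
      rootA n ^ k • (clockMatrix n ^ k * shiftMatrix n) := by
  induction k with
  | zero => simp
  | succ k ih =>
    rw [pow_succ, ← mul_assoc, ih, smul_mul_assoc, mul_assoc, shiftMatrix_mul_clockMatrix hn,
      mul_smul_comm, smul_smul, mul_assoc, pow_succ]

theorem clockMatrix_lie_weyl {n : ℕ} (hn : 2 ≤ n) (k m : ℕ) :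
    ⁅clockMatrix n, weyl n k m⁆ = (1 - rootA n ^ m) • weyl n (k + 1) m := by
  rw [Ring.lie_def, weyl, weyl, mul_assoc, shiftMatrix_pow_mul_clockMatrix hn, mul_smul_comm,
    ← mul_assoc, ← mul_assoc, ← pow_succ, ← pow_succ', sub_smul, one_smul]

theorem shiftMatrix_lie_weyl {n : ℕ} (hn : 2 ≤ n) (k m : ℕ) :
    ⁅shiftMatrix n, weyl n k m⁆ = (rootA n ^ k - 1) • weyl n k (m + 1) := by
  rw [Ring.lie_def, weyl, weyl, ← mul_assoc, shiftMatrix_mul_clockMatrix_pow hn,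
    smul_mul_assoc, mul_assoc, mul_assoc, ← pow_succ, ← pow_succ', sub_smul, one_smul]

theorem iterAd_clockMatrix_weyl {n : ℕ} (hn : 2 ≤ n) (j k m : ℕ) :
    iterAd (clockMatrix n) j (weyl n k m) = (1 - rootA n ^ m) ^ j • weyl n (k + j) m := by
  induction j with
  | zero => simp [iterAd_zero]
  | succ j ih =>
    rw [iterAd_succ, ih, lie_smul, clockMatrix_lie_weyl hn, smul_smul, ← pow_succ, add_assoc]

theorem iterAd_shiftMatrix_weyl {n : ℕ} (hn : 2 ≤ n) (j k m : ℕ) :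
    iterAd (shiftMatrix n) j (weyl n k m) = (rootA n ^ k - 1) ^ j • weyl n k (m + j) := by
  induction j with
  | zero => simp [iterAd_zero]
  | succ j ih =>
    rw [iterAd_succ, ih, lie_smul, shiftMatrix_lie_weyl hn, smul_smul, ← pow_succ, add_assoc]

theorem weyl_one_zero (n : ℕ) : weyl n 1 0 = clockMatrix n := by simp [weyl]

theorem weyl_zero_one (n : ℕ) : weyl n 0 1 = shiftMatrix n := by simp [weyl]

theorem clockMatrix_lie_shiftMatrix {n : ℕ} (hn : 2 ≤ n) :
    ⁅clockMatrix n, shiftMatrix n⁆ = (1 - rootA n) • weyl n 1 1 := by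
  have := clockMatrix_lie_weyl hn 0 1
  rwa [weyl_zero_one, zero_add, pow_one] at this

theorem iterAd_shiftMatrix_lie {n : ℕ} (hn : 2 ≤ n) (j : ℕ) :
    iterAd (shiftMatrix n) j ⁅clockMatrix n, shiftMatrix n⁆ =
      ((1 - rootA n) * (rootA n - 1) ^ j) • weyl n 1 (j + 1) := by
  rw [clockMatrix_lie_shiftMatrix hn, iterAd_smul, iterAd_shiftMatrix_weyl hn, smul_smul,
    pow_one, add_comm]

theorem T_matrix {n : ℕ} (hn : 2 ≤ n) {m k : ℕ} (hm : 1 ≤ m) (hmn : m < n) (hk : 1 ≤ k) :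
    T n (clockMatrix n) (shiftMatrix n) m k =
      ((1 - rootA n) * (rootA n - 1) ^ (m - 1) * (1 - rootA n ^ m) ^ (k - 1)) •
        weyl n k m := by
  rw [T_of_ne _ _ _ hmn.ne, iterAd_shiftMatrix_lie hn, iterAd_smul, iterAd_clockMatrix_weyl hn,
    smul_smul, Nat.sub_add_cancel hm, Nat.add_sub_cancel' hk]

/-- `S^n = 1` wraps the exponent to `0`. The last factor vanishes at `k = n`, and `k = 1` gives a
multiple of `D`: hence the two exclusions for `m = n`. -/
theorem T_matrix_self {n : ℕ} (hn : 2 ≤ n) {k : ℕ} (hk : 1 ≤ k) :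
    T n (clockMatrix n) (shiftMatrix n) n k =
      ((1 - rootA n) * (rootA n - 1) ^ (n - 2) * (1 - rootA n ^ (n - 1)) ^ (k - 1) *
        (rootA n ^ k - 1)) • weyl n k 0 := by
  rw [T_self hn, T_matrix hn (by omega) (by omega) hk, lie_smul, shiftMatrix_lie_weyl hn,
    smul_smul, Nat.sub_add_cancel (by omega : 1 ≤ n), ← weyl_add_right n k 0, zero_add,
    Nat.sub_sub]

theorem Relation.matrix_eq {n : ℕ} (hn : 2 ≤ n) {l r : Matrix (Fin n) (Fin n) ℂ}
    (h : Relation n (clockMatrix n) (shiftMatrix n) l r) : l = r := by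
  have hneg : rootA n - 1 = (-1) * (1 - rootA n) := by ring
  have hne : 1 - rootA n ≠ 0 := by
    simpa using one_sub_rootA_pow_ne_zero hn le_rfl (by omega : 1 < n)
  cases h with
  | rel1 =>
    rw [← weyl_zero_one, iterAd_clockMatrix_weyl hn, weyl_add_left hn, pow_one]
  | rel2 m hm hm' =>
    rw [iterAd_shiftMatrix_lie hn, iterAd_smul, iterAd_clockMatrix_weyl hn, weyl_add_left hn,
      Nat.sub_add_cancel (by omega : 1 ≤ m), smul_comm]
  | rel3 =>
    rw [← T_self hn, T_matrix_self hn le_rfl, weyl_one_zero, hneg]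
    obtain ⟨n, rfl⟩ := Nat.exists_eq_add_of_le' hn
    congr 1
    simp only [Nat.add_sub_cancel, Nat.sub_self, pow_zero, pow_one, mul_pow,
      show n + 2 - 1 = n + 1 by omega]
    linear_combination (1 - rootA (n + 2)) * (-1) ^ n * (1 - rootA (n + 2)) ^ n * hneg
  | rel4 =>
    rw [← T_self hn, T_matrix_self hn (by omega), (rootA_isPrimitiveRoot hn).pow_eq_one,
      sub_self, mul_zero, zero_smul]
  | rel5 k hk hk' =>
    rw [T_matrix_self hn (by omega), T_matrix hn le_rfl (by omega) (by omega), lie_smul,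
      shiftMatrix_lie_weyl hn, smul_smul, smul_smul, hneg]
    -- With `j = k - 1` and `q = n - k - 1`, the power `(1 - a)^(n-2)` splits into the `q` factors
    -- of the stated coefficient and the `j` factors inside `T_1^k`.
    obtain ⟨j, rfl⟩ := Nat.exists_eq_add_of_le' (by omega : 1 ≤ k)
    obtain ⟨q, hq⟩ := Nat.exists_eq_add_of_le (by omega : j + 1 + 1 ≤ n)
    have h2 : n - 2 = q + j := by omega
    have h1 : n - (j + 1) - 1 = q := by omega
    have h3 : (-1 : ℂ) ^ n = (-1) ^ (q + j) := by
      rw [hq, show j + 1 + 1 + q = q + j + 2 by ring, pow_add]; norm_num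
    rw [h2, h1, h3]
    congr 1
    simp only [Nat.add_sub_cancel, Nat.sub_self, pow_zero, pow_one, mul_pow]
    ring
  | rel6 k hk hk' =>
    rw [T_matrix_self hn (by omega), lie_smul, clockMatrix_lie_weyl hn]
    simp
  | path m k s₁ s₂ hm hm' hk hk' hmk hs hs₁ =>
    have hne' : 1 - rootA n ^ m ≠ 0 := one_sub_rootA_pow_ne_zero hn (by omega) (by omega)
    obtain ⟨j, rfl⟩ := Nat.exists_eq_add_of_le' hk
    have hmeq : m = s₁ + s₂ + 1 := by omega
    subst hmeq
    rw [T_matrix hn le_rfl (by omega) le_rfl, T_matrix hn (by omega) (by omega) hk, iterAd_smul,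
      iterAd_smul, iterAd_smul, iterAd_shiftMatrix_weyl hn, iterAd_smul, iterAd_smul,
      iterAd_clockMatrix_weyl hn, iterAd_smul, iterAd_shiftMatrix_weyl hn]
    simp only [smul_smul, Nat.add_sub_cancel, Nat.sub_self, pow_zero, mul_one, pow_one,
      add_comm 1 j, show 1 + s₂ + s₁ = s₁ + s₂ + 1 by ring]
    congr 1
    rw [add_comm 1 s₂]
    have hneg' : rootA n ^ (j + 1) - 1 = (-1) * (1 - rootA n ^ (j + 1)) := by ring
    rw [hneg, hneg', div_pow, div_pow, mul_pow, mul_pow, mul_pow, pow_add (1 - rootA n), pow_add (-1)]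
    field_simp

/-! ### The basis of `sl(n)` -/

/-- The exponents `(k, m)` of the monomial that a member of the basis is a multiple of. -/
def exponents (n : ℕ) : Gen ⊕ BasisIndex n → ℕ × ℕ
  | Sum.inl Gen.D => (1, 0)
  | Sum.inl Gen.S => (0, 1)
  | Sum.inr p => (p.1.2 % n, p.1.1 % n)

theorem exponents_lt {n : ℕ} (hn : 2 ≤ n) (i : Gen ⊕ BasisIndex n) :
    (exponents n i).1 < n ∧ (exponents n i).2 < n := by
  rcases i with (_ | _) | p
  · exact ⟨by change 1 < n; omega, by change 0 < n; omega⟩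
  · exact ⟨by change 0 < n; omega, by change 1 < n; omega⟩
  · exact ⟨Nat.mod_lt _ (by omega), Nat.mod_lt _ (by omega)⟩

theorem mod_eq_ite {n k : ℕ} (hk : k ≤ n) : k % n = if k = n then 0 else k := by
  split_ifs with h
  · rw [h, Nat.mod_self]
  · exact Nat.mod_eq_of_lt (by omega)

/-- On `1, …, n` reduction mod `n` only renames `n` to `0`, so the only possible collisions are
`T_1^n` with `S` and `T_n^1` with `D`, both excluded. -/
theorem exponents_injective {n : ℕ} (hn : 2 ≤ n) : Function.Injective (exponents n) := by
  rintro ((_ | _) | ⟨⟨m, k⟩, ⟨hm, hm'⟩, ⟨hk, hk'⟩, h1, h2⟩)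
    ((_ | _) | ⟨⟨m', k'⟩, ⟨hm₁, hm₁'⟩, ⟨hk₁, hk₁'⟩, h1', h2'⟩) h <;>
  simp only [exponents, Prod.mk.injEq] at * <;>
  first
  | rfl
  | omega
  | (rw [mod_eq_ite (by assumption), mod_eq_ite (by assumption)] at h
     split_ifs at h <;> omega)
  | (rw [mod_eq_ite hk', mod_eq_ite hm', mod_eq_ite hk₁', mod_eq_ite hm₁'] at h
     have : m = m' ∧ k = k' := by split_ifs at h <;> omega
     obtain ⟨rfl, rfl⟩ := this
     rfl)

theorem exists_exponents_eq {n k m : ℕ} (hn : 2 ≤ n) (hk : k < n) (hm : m < n)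
    (h : (k, m) ≠ (0, 0)) : ∃ i, exponents n i = (k, m) := by
  have h0 : ¬(k = 0 ∧ m = 0) := fun h' => h (by rw [h'.1, h'.2])
  by_cases hD : k = 1 ∧ m = 0
  · exact ⟨Sum.inl Gen.D, by rw [hD.1, hD.2]; rfl⟩
  by_cases hS : k = 0 ∧ m = 1
  · exact ⟨Sum.inl Gen.S, by rw [hS.1, hS.2]; rfl⟩
  refine ⟨Sum.inr ⟨(if m = 0 then n else m, if k = 0 then n else k), ?_⟩, ?_⟩
  · dsimp only
    split_ifs <;> omega
  · simp only [exponents, Prod.mk.injEq]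
    constructor <;> split_ifs with h'
    · rw [h', Nat.mod_self]
    · exact Nat.mod_eq_of_lt hk
    · rw [h', Nat.mod_self]
    · exact Nat.mod_eq_of_lt hm

theorem weyl_mod {n : ℕ} (hn : 2 ≤ n) {k m : ℕ} (hk : k ≤ n) (hm : m ≤ n) :
    weyl n (k % n) (m % n) = weyl n k m := by
  have h1 (m : ℕ) : weyl n n m = weyl n 0 m := by simpa using weyl_add_left hn 0 m
  have h2 (k : ℕ) : weyl n k n = weyl n k 0 := by simpa using weyl_add_right n k 0
  rw [mod_eq_ite hk, mod_eq_ite hm]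
  split_ifs with ha hb hb <;> simp only [ha, hb, h1, h2]

/-- All factors of the coefficients are `1 - a^j` with `0 < j < n`, up to sign, and `a` is
primitive. -/
theorem exists_basisFamily_eq_smul {n : ℕ} (hn : 2 ≤ n) (i : Gen ⊕ BasisIndex n) :
    ∃ c : ℂˣ, basisFamily n (clockMatrix n) (shiftMatrix n) i =
      c • weyl n (exponents n i).1 (exponents n i).2 := by
  have hne : 1 - rootA n ≠ 0 := by
    simpa using one_sub_rootA_pow_ne_zero hn le_rfl (by omega : 1 < n)
  have hne' : rootA n - 1 ≠ 0 := by rwa [← neg_sub, neg_ne_zero]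
  rcases i with (_ | _) | ⟨⟨m, k⟩, ⟨hm, hm'⟩, ⟨hk, hk'⟩, h1, h2⟩
  · exact ⟨1, by rw [one_smul]; exact (weyl_one_zero n).symm⟩
  · exact ⟨1, by rw [one_smul]; exact (weyl_zero_one n).symm⟩
  dsimp only at hm hm' hk hk' h1 h2
  change ∃ c : ℂˣ, T n _ _ m k = c • weyl n (k % n) (m % n)
  suffices ∃ c : ℂ, c ≠ 0 ∧ T n (clockMatrix n) (shiftMatrix n) m k = c • weyl n k m by
    obtain ⟨c, hc, h⟩ := this
    exact ⟨Units.mk0 c hc, by rw [h, weyl_mod hn hk' hm']; rfl⟩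
  rcases eq_or_ne m n with rfl | hmn
  · refine ⟨_, ?_, by
      rw [T_matrix_self hn hk, ← weyl_add_right m k 0, zero_add]⟩
    have h3 : rootA m ^ k - 1 ≠ 0 := by
      rw [← neg_sub, neg_ne_zero]
      exact one_sub_rootA_pow_ne_zero hn hk (by omega)
    have h4 := one_sub_rootA_pow_ne_zero hn (by omega : 1 ≤ m - 1) (by omega)
    exact mul_ne_zero (mul_ne_zero (mul_ne_zero hne (pow_ne_zero _ hne')) (pow_ne_zero _ h4)) h3
  · refine ⟨_, ?_, T_matrix hn hm (by omega) hk⟩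
    have h4 := one_sub_rootA_pow_ne_zero hn hm (by omega)
    exact mul_ne_zero (mul_ne_zero hne (pow_ne_zero _ hne')) (pow_ne_zero _ h4)

/-- At position `(i, i + m mod n)` only monomials with shift exponent `m` contribute, giving `∑ k, c
(k, m) (a^i)^k = 0`. The `n` nodes `a^i` are distinct, so the Vandermonde system forces `c = 0`. -/
theorem linearIndependent_weyl {n : ℕ} (hn : 2 ≤ n) :
    LinearIndependent ℂ fun p : Fin n × Fin n => weyl n p.1 p.2 := by
  rw [Fintype.linearIndependent_iff]
  rintro c hc ⟨k, m⟩
  have hinj : Function.Injective fun i : Fin n => rootA n ^ (i : ℕ) := fun i j h =>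
    Fin.ext ((rootA_isPrimitiveRoot hn).pow_inj i.isLt j.isLt h)
  have key : (fun k => c (k, m)) = 0 := by
    refine Matrix.eq_zero_of_forall_index_sum_mul_pow_eq_zero hinj fun i => ?_
    have hlt : ((i : ℕ) + m) % n < n := Nat.mod_lt _ (by omega)
    have h := congrFun (congrFun hc i) ⟨_, hlt⟩
    rw [Fintype.sum_prod_type] at h
    simp only [Matrix.sum_apply, Matrix.smul_apply, weyl_apply, Matrix.zero_apply] at h
    rw [← h]
    refine Finset.sum_congr rfl fun k _ => ?_
    rw [Finset.sum_eq_single m]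
    · simp
    · intro m' _ hm'
      rw [if_neg, smul_zero]
      intro h'
      apply hm'
      have := Nat.ModEq.add_left_cancel' (i : ℕ) h'
      exact (Fin.ext (by
        rwa [Nat.ModEq, Nat.mod_eq_of_lt m.isLt, Nat.mod_eq_of_lt m'.isLt] at this)).symm
    · simp
  exact congrFun key k

theorem span_weyl_eq_top {n : ℕ} (hn : 2 ≤ n) :
    Submodule.span ℂ (Set.range fun p : Fin n × Fin n => weyl n p.1 p.2) = ⊤ :=
  (linearIndependent_weyl hn).span_eq_top_of_card_eq_finrank' (by simp [Module.finrank_matrix])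

theorem val_basisFamily {n : ℕ} (hn : 2 ≤ n) (i : Gen ⊕ BasisIndex n) :
    (basisFamily n (clock n hn) (shift n hn) i).val =
      basisFamily n (clockMatrix n) (shiftMatrix n) i :=
  map_basisFamily (LieAlgebra.SpecialLinear.sl (Fin n) ℂ).incl n (clock n hn) (shift n hn) i

theorem Relation.clock_shift_eq {n : ℕ} (hn : 2 ≤ n)
    {l r : LieAlgebra.SpecialLinear.sl (Fin n) ℂ}
    (h : Relation n (clock n hn) (shift n hn) l r) : l = r :=
  Subtype.ext (Relation.matrix_eq hn (h.map (LieAlgebra.SpecialLinear.sl (Fin n) ℂ).incl))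

theorem linearIndependent_basisFamily {n : ℕ} (hn : 2 ≤ n) :
    LinearIndependent ℂ (basisFamily n (clock n hn) (shift n hn)) := by
  apply LinearIndependent.of_comp (LieAlgebra.SpecialLinear.sl (Fin n) ℂ).incl.toLinearMap
  choose c hc using exists_basisFamily_eq_smul hn
  let e (i : Gen ⊕ BasisIndex n) : Fin n × Fin n :=
    (⟨_, (exponents_lt hn i).1⟩, ⟨_, (exponents_lt hn i).2⟩)
  have he : Function.Injective e := fun i j h => exponents_injective hn <| by
    simp only [e, Prod.mk.injEq, Fin.mk.injEq] at h
    exact Prod.ext h.1 h.2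
  have h := ((linearIndependent_weyl hn).comp e he).units_smul c
  have heq : (c • (fun p : Fin n × Fin n => weyl n p.1 p.2) ∘ e) =
      fun i => (basisFamily n (clock n hn) (shift n hn) i).val :=
    funext fun i => ((val_basisFamily hn i).trans (hc i)).symm
  rw [heq] at h
  exact h

theorem span_basisFamily_clock_shift {n : ℕ} (hn : 2 ≤ n) :
    Submodule.span ℂ (Set.range (basisFamily n (clock n hn) (shift n hn))) = ⊤ := by
  have : NeZero n := ⟨by omega⟩
  set V := Submodule.span ℂ (Set.range (basisFamily n (clock n hn) (shift n hn)))
  have hW (p : Fin n × Fin n) (hp : p ≠ 0) :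
      ∃ v ∈ V, (v : Matrix (Fin n) (Fin n) ℂ) = weyl n p.1 p.2 := by
    obtain ⟨i, hi⟩ := exists_exponents_eq hn p.1.isLt p.2.isLt (by
      intro h
      simp only [Prod.mk.injEq] at h
      exact hp (Prod.ext (Fin.ext h.1) (Fin.ext h.2)))
    obtain ⟨c, hc⟩ := exists_basisFamily_eq_smul hn i
    rw [hi, ← val_basisFamily hn] at hc
    refine ⟨(↑c⁻¹ : ℂ) • basisFamily n (clock n hn) (shift n hn) i,
      V.smul_mem _ (Submodule.subset_span ⟨i, rfl⟩), ?_⟩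
    change (↑c⁻¹ : ℂ) • (basisFamily n (clock n hn) (shift n hn) i).val = _
    rw [hc]
    exact inv_smul_smul c _
  choose! v hvV hv using hW
  rw [eq_top_iff]
  rintro x -
  obtain ⟨c, hc⟩ := (Submodule.mem_span_range_iff_exists_fun ℂ).1
    (span_weyl_eq_top hn ▸ Submodule.mem_top (x := (x : Matrix (Fin n) (Fin n) ℂ)))
  -- Index `0` is the identity matrix, of trace `n ≠ 0`; since `x` and the rest `y` are traceless,
  -- its coefficient vanishes.
  let y : LieAlgebra.SpecialLinear.sl (Fin n) ℂ := ∑ p ∈ Finset.univ.erase 0, c p • v p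
  have hy : y ∈ V := Submodule.sum_mem _ fun p hp =>
    V.smul_mem _ (hvV p (Finset.ne_of_mem_erase hp))
  have hxy : (x : Matrix (Fin n) (Fin n) ℂ) = c 0 • (1 : Matrix (Fin n) (Fin n) ℂ) + y := by
    have hy' : (y : Matrix (Fin n) (Fin n) ℂ) =
        ∑ p ∈ Finset.univ.erase 0, c p • weyl n p.1 p.2 := by
      change (LieAlgebra.SpecialLinear.sl (Fin n) ℂ).incl.toLinearMap y = _
      rw [map_sum]
      exact Finset.sum_congr rfl fun p hp => by
        rw [map_smul, ← hv p (Finset.ne_of_mem_erase hp)]; rfl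
    rw [hy', ← hc, ← Finset.add_sum_erase _ _ (Finset.mem_univ (0 : Fin n × Fin n))]
    simp [weyl]
  have hx0 : (x : Matrix (Fin n) (Fin n) ℂ).trace = 0 := x.2
  have hy0 : (y : Matrix (Fin n) (Fin n) ℂ).trace = 0 := y.2
  have hc0 : c 0 = 0 := by
    rw [hxy, Matrix.trace_add, hy0, Matrix.trace_smul, Matrix.trace_one] at hx0
    simpa [NeZero.ne n] using hx0
  rw [hc0, zero_smul, zero_add] at hxy
  rwa [Subtype.ext hxy]

theorem lieSpan_clock_shift {n : ℕ} (hn : 2 ≤ n) :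
    LieSubalgebra.lieSpan ℂ (LieAlgebra.SpecialLinear.sl (Fin n) ℂ)
      {clock n hn, shift n hn} = ⊤ := by
  set K := LieSubalgebra.lieSpan ℂ (LieAlgebra.SpecialLinear.sl (Fin n) ℂ)
    {clock n hn, shift n hn}
  have hd : clock n hn ∈ K := LieSubalgebra.subset_lieSpan (Or.inl rfl)
  have hs : shift n hn ∈ K := LieSubalgebra.subset_lieSpan (Or.inr rfl)
  have hle : Submodule.span ℂ (Set.range (basisFamily n (clock n hn) (shift n hn))) ≤
      K.toSubmodule := Submodule.span_le.2 <| by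
    rintro _ ⟨i, rfl⟩
    exact basisFamily_mem K hd hs i
  rw [span_basisFamily_clock_shift hn] at hle
  exact eq_top_iff.2 fun x _ => hle Submodule.mem_top

/-! ### Free Lie algebra, quotients and the presentation -/

/-- The universal property gives a morphism into the subalgebra `K` generated by the letters;
followed by the inclusion it fixes the letters, so it is the identity and `K` is everything. -/
theorem lieSpan_range_of_eq_top (X : Type*) :
    LieSubalgebra.lieSpan ℂ (FreeLieAlgebra ℂ X) (Set.range (FreeLieAlgebra.of ℂ)) = ⊤ := by
  set K := LieSubalgebra.lieSpan ℂ (FreeLieAlgebra ℂ X) (Set.range (FreeLieAlgebra.of ℂ))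
  let f : FreeLieAlgebra ℂ X →ₗ⁅ℂ⁆ K :=
    FreeLieAlgebra.lift ℂ fun x => ⟨FreeLieAlgebra.of ℂ x, LieSubalgebra.subset_lieSpan ⟨x, rfl⟩⟩
  have hf : K.incl.comp f = LieHom.id := FreeLieAlgebra.hom_ext fun x => by simp [f]
  exact eq_top_iff.2 fun x _ => by
    have := congrArg (fun g : FreeLieAlgebra ℂ X →ₗ⁅ℂ⁆ FreeLieAlgebra ℂ X => g x) hf
    have hx : ((f x : K) : FreeLieAlgebra ℂ X) = x := this
    exact hx ▸ (f x).2

section Quotient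

variable {L M : Type*} [LieRing L] [LieAlgebra ℂ L] [LieRing M] [LieAlgebra ℂ M]

/-- The projection onto the quotient by an ideal, as a morphism of Lie algebras. -/
def quotientMk (I : LieIdeal ℂ L) : L →ₗ⁅ℂ⁆ L ⧸ I :=
  { (LieSubmodule.Quotient.mk' I : L →ₗ[ℂ] L ⧸ I) with
    map_lie' := fun {x y} => LieSubmodule.Quotient.mk_bracket I x y }

theorem quotientMk_surjective (I : LieIdeal ℂ L) : Function.Surjective (quotientMk I) :=
  LieSubmodule.Quotient.surjective_mk' I

theorem quotientMk_eq_zero {I : LieIdeal ℂ L} {x : L} : quotientMk I x = 0 ↔ x ∈ I :=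
  LieSubmodule.Quotient.mk_eq_zero I

theorem exists_quotient_equiv {I : LieIdeal ℂ L} {f : L →ₗ⁅ℂ⁆ M} (hI : I = f.ker)
    (hf : Function.Surjective f) :
    ∃ e : (L ⧸ I) ≃ₗ⁅ℂ⁆ M, ∀ x, e (LieSubmodule.Quotient.mk x) = f x := by
  subst hI
  let g : f.range →ₗ⁅ℂ⁆ M := f.range.incl
  have hg : Function.Bijective g :=
    ⟨Subtype.val_injective, fun y => ⟨⟨y, hf y⟩, rfl⟩⟩
  exact ⟨f.quotKerEquivRange.trans (LieEquiv.ofBijective g hg), fun x => rfl⟩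

theorem lieSpan_pair_map_eq_top {d s : L} (h : LieSubalgebra.lieSpan ℂ L {d, s} = ⊤)
    {f : L →ₗ⁅ℂ⁆ M} (hf : Function.Surjective f) :
    LieSubalgebra.lieSpan ℂ M {f d, f s} = ⊤ := by
  rw [← Set.image_pair, ← LieSubalgebra.map_lieSpan, h, eq_top_iff]
  intro y _
  obtain ⟨x, rfl⟩ := hf y
  exact ⟨x, trivial, rfl⟩

/-- If the images of the `T_m^k` and of the two generators under `f` are linearly independent,
and their images modulo an ideal `I` contained in the kernel of `f` span, then `I` is the
kernel. -/
theorem eq_ker_of_basisFamily {n : ℕ} {d s : L} {I : LieIdeal ℂ L} {f : L →ₗ⁅ℂ⁆ M}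
    (hI : I ≤ f.ker)
    (hspan : Submodule.span ℂ
      (Set.range (basisFamily n (quotientMk I d) (quotientMk I s))) = ⊤)
    (hind : LinearIndependent ℂ (basisFamily n (f d) (f s))) : I = f.ker := by
  refine le_antisymm hI fun x hx => ?_
  obtain ⟨c, hc⟩ := Finsupp.mem_span_range_iff_exists_finsupp.1
    (hspan ▸ Submodule.mem_top (x := quotientMk I x))
  -- The combination representing `x` modulo `I`, lifted to `L`. Both `x` and `x - y` lie in the
  -- kernel of `f`, so `f y = 0`; independence then gives `c = 0` and `x ∈ I`.
  set y : L := c.sum fun i a => a • basisFamily n d s i with hy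
  have hqy : quotientMk I y = quotientMk I x := by
    rw [← hc, hy, map_finsuppSum]
    simp only [map_smul, map_basisFamily]
  have hxy : x - y ∈ I := quotientMk_eq_zero.1 (by rw [map_sub, hqy, sub_self])
  have hfy : f y = 0 := by
    have h1 : f (x - y) = 0 := (LieHom.mem_ker).1 (hI hxy)
    rw [map_sub, (LieHom.mem_ker).1 hx, zero_sub, neg_eq_zero] at h1
    exact h1
  have hc0 : c = 0 := by
    refine linearIndependent_iff.1 hind c ?_
    rw [Finsupp.linearCombination_apply, ← hfy, hy, map_finsuppSum]
    simp only [map_smul, map_basisFamily]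
  rw [hc0, Finsupp.sum_zero_index] at hy
  rwa [hy, sub_zero] at hxy

end Quotient

theorem lieSpan_of_eq_top :
    LieSubalgebra.lieSpan ℂ (FreeLieAlgebra ℂ Gen)
      {FreeLieAlgebra.of ℂ Gen.D, FreeLieAlgebra.of ℂ Gen.S} = ⊤ := by
  rw [← lieSpan_range_of_eq_top Gen]
  congr 1
  ext x
  constructor
  · rintro (rfl | rfl)
    · exact ⟨_, rfl⟩
    · exact ⟨_, rfl⟩
  · rintro ⟨_ | _, rfl⟩
    · exact Or.inl rfl
    · exact Or.inr rfl

/-- The morphism from the free Lie algebra to `sl(n)` sending the letters to the clock and shift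
matrices. -/
noncomputable def evalHom {n : ℕ} (hn : 2 ≤ n) :
    FreeLieAlgebra ℂ Gen →ₗ⁅ℂ⁆ LieAlgebra.SpecialLinear.sl (Fin n) ℂ :=
  FreeLieAlgebra.lift ℂ fun
    | Gen.D => clock n hn
    | Gen.S => shift n hn

theorem evalHom_D {n : ℕ} (hn : 2 ≤ n) : evalHom hn (FreeLieAlgebra.of ℂ Gen.D) = clock n hn :=
  FreeLieAlgebra.lift_of_apply _ _

theorem evalHom_S {n : ℕ} (hn : 2 ≤ n) : evalHom hn (FreeLieAlgebra.of ℂ Gen.S) = shift n hn :=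
  FreeLieAlgebra.lift_of_apply _ _

theorem evalHom_surjective {n : ℕ} (hn : 2 ≤ n) : Function.Surjective (evalHom hn) := by
  have h : LieSubalgebra.lieSpan ℂ _ {clock n hn, shift n hn} ≤ (evalHom hn).range :=
    LieSubalgebra.lieSpan_le.2 <| by
      rintro x (rfl | rfl)
      · exact ⟨_, evalHom_D hn⟩
      · exact ⟨_, evalHom_S hn⟩
  rw [lieSpan_clock_shift hn] at h
  exact fun x => h (LieSubalgebra.mem_top x)

theorem relationIdeal_eq_ker {n : ℕ} (hn : 2 ≤ n) : relationIdeal n = (evalHom hn).ker := by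
  refine eq_ker_of_basisFamily (n := n) (d := FreeLieAlgebra.of ℂ Gen.D)
    (s := FreeLieAlgebra.of ℂ Gen.S) ?_ ?_ ?_
  · refine LieSubmodule.lieSpan_le.2 ?_
    rintro _ ⟨l, r, h, rfl⟩
    have := h.map (evalHom hn)
    rw [evalHom_D, evalHom_S] at this
    exact (LieHom.mem_ker).2 (by rw [map_sub, this.clock_shift_eq hn, sub_self])
  · set d : FreeLieAlgebra ℂ Gen := FreeLieAlgebra.of ℂ Gen.D
    set s : FreeLieAlgebra ℂ Gen := FreeLieAlgebra.of ℂ Gen.S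
    refine span_basisFamily_eq_top hn
      (lieSpan_pair_map_eq_top lieSpan_of_eq_top (quotientMk_surjective _)) fun l r h => ?_
    obtain ⟨l, r, hlr, rfl, rfl⟩ := h.exists_lift
    rw [← sub_eq_zero, ← map_sub, quotientMk_eq_zero]
    exact LieSubmodule.subset_lieSpan ⟨l, r, hlr, rfl⟩
  · rw [evalHom_D, evalHom_S]
    exact linearIndependent_basisFamily hn

end Sylvester

/-- The clock and shift matrices generate `sl(n)` as a Lie algebra; `D`, `S` and the listed
iterated brackets are a basis; and `sl(n)` is the quotient of the free Lie algebra on two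
generators by the ideal of the listed relations, the generators going to `D` and `S`. -/
theorem theorem1 (n : ℕ) (hn : 2 ≤ n) :
    LieSubalgebra.lieSpan ℂ (LieAlgebra.SpecialLinear.sl (Fin n) ℂ)
        {Sylvester.clock n hn, Sylvester.shift n hn} = ⊤ ∧
    (LinearIndependent ℂ
        (Sylvester.basisFamily n (Sylvester.clock n hn) (Sylvester.shift n hn)) ∧
      Submodule.span ℂ (Set.range
        (Sylvester.basisFamily n (Sylvester.clock n hn) (Sylvester.shift n hn))) = ⊤) ∧
    ∃ e : (FreeLieAlgebra ℂ Sylvester.Gen ⧸ Sylvester.relationIdeal n) ≃ₗ⁅ℂ⁆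
        LieAlgebra.SpecialLinear.sl (Fin n) ℂ,
      e (LieSubmodule.Quotient.mk (FreeLieAlgebra.of ℂ Sylvester.Gen.D)) =
        Sylvester.clock n hn ∧
      e (LieSubmodule.Quotient.mk (FreeLieAlgebra.of ℂ Sylvester.Gen.S)) =
        Sylvester.shift n hn := by
  obtain ⟨e, he⟩ := Sylvester.exists_quotient_equiv (Sylvester.relationIdeal_eq_ker hn)
    (Sylvester.evalHom_surjective hn)
  exact ⟨Sylvester.lieSpan_clock_shift hn,
    ⟨Sylvester.linearIndependent_basisFamily hn, Sylvester.span_basisFamily_clock_shift hn⟩,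
    e, (he _).trans (Sylvester.evalHom_D hn), (he _).trans (Sylvester.evalHom_S hn)⟩
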